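/- There are polynomials $\Phi\in\mathbb{N}[S,N,D]$ and $T\in\mathbb{N}[D]$ such that the following holds. Let $\mathbb{F}$ be a field, let $s,n,d\ge 0$ be integers, and suppose that $\operatorname{char}\mathbb{F}$ is $0$ or at least $T(d)$. Let $f\in\mathbb{F}[x_1,\dots,x_n]$ be a nonzero polynomial of total degree $d$ that can be computed by an arithmetic circuit of size at most $s$, and let $g\in\mathbb{F}[x_1,\dots,x_n]$ divide $f$. Then $g$ can be computed by an arithmetic circuit over $\mathbb{F}$ of size at most $\Phi(s,n,d)$. In particular, $\mathsf{VP}$ is closed under taking factors: let $\mathbb{F}$ be a field of characteristic $0$, and let $(f_m)_{m\in\mathbb{N}}$ be a family of nonzero polynomials $f_m\in\mathbb{F}[x_1,\dots,x_{n(m)}]$ in $\mathsf{VP}$. If $g_m\in\mathbb{F}[x_1,\dots,x_{n(m)}]$ divides $f_m$ for every $m$, then $(g_m)_{m\in\mathbb{N}}$ is in $\mathsf{VP}$. Here an arithmetic circuit over $\mathbb{F}$ is a finite directed acyclic graph (parallel edges allowed) whose gates of in-degree zero are labelled by variables or elements of $\mathbb{F}$ and whose other gates are labelled $+$ or $\times$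 and compute the sum or the product of the polynomials at their predecessors, counted with multiplicity. Its size is its number of edges, and it computes the polynomials at its gates of out-degree zero. A family $(f_m)$ is in $\mathsf{VP}$ if $n(m)$, $\deg f_m$ and the least size of a circuit computing $f_m$ are all bounded by a polynomial in $m$. -/

import Mathlib

/-- The label of a gate of an arithmetic circuit over the field `F` and the variables
`x_0, …, x_{n-1}`. -/
inductive GateLabel (F : Type*) (n : ℕ) where
  | var (k : Fin n) : GateLabel F n
  | const (c : F) : GateLabel F n
  | sum : GateLabel F n
  | prod : GateLabel F n

/-- The labels of input gates: a variable or a field element. -/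
def GateLabel.IsInput {F : Type*} {n : ℕ} : GateLabel F n → Prop
  | .var _ => True
  | .const _ => True
  | .sum => False
  | .prod => False

/-- An arithmetic circuit over `F` and `n` variables: a finite directed acyclic graph whose
vertices (gates) are numbered in a topological order. `preds i` is the multiset of tails of the
edges that enter gate `i`; parallel edges are allowed (a product gate may multiply a gate with
itself) and count with multiplicity. Fan-in and fan-out are unbounded. -/
structure ArithCircuit (F : Type*) (n : ℕ) where
  numGates : ℕ
  label : Fin numGates → GateLabel F n
  preds : Fin numGates → Multiset (Fin numGates)
  acyclic : ∀ i, ∀ j ∈ preds i, j < i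
  /-- The gates of in-degree zero are exactly those labelled by a variable or a field element. -/
  isInput_iff : ∀ i, (label i).IsInput ↔ preds i = 0

namespace ArithCircuit

variable {F : Type*} {n : ℕ}

/-- The size of a circuit is its number of edges. -/
def size (C : ArithCircuit F n) : ℕ := ∑ i, (C.preds i).card

/-- An output gate is a gate of out-degree zero. -/
def IsOutput (C : ArithCircuit F n) (i : Fin C.numGates) : Prop := ∀ j, i ∉ C.preds j

/-- The polynomial computed at a gate. -/
noncomputable def gatePoly [CommSemiring F] (C : ArithCircuit F n) (i : Fin C.numGates) :
    MvPolynomial (Fin n) F :=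
  match C.label i with
  | .var k => MvPolynomial.X k
  | .const c => MvPolynomial.C c
  | .sum => ((C.preds i).attach.map fun j => C.gatePoly j.1).sum
  | .prod => ((C.preds i).attach.map fun j => C.gatePoly j.1).prod
termination_by i
decreasing_by all_goals exact C.acyclic i j.1 j.2

/-- The circuit computes `f` if `f` is the polynomial at one of its output gates. -/
def Computes [CommSemiring F] (C : ArithCircuit F n) (f : MvPolynomial (Fin n) F) : Prop :=
  ∃ i, C.IsOutput i ∧ C.gatePoly i = f

end ArithCircuit

/-- `f` can be computed by an arithmetic circuit of size at most `s`. -/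
def HasCircuitOfSize {F : Type*} [CommSemiring F] {n : ℕ} (f : MvPolynomial (Fin n) F)
    (s : ℕ) : Prop :=
  ∃ C : ArithCircuit F n, C.Computes f ∧ C.size ≤ s

/-- A function of one parameter that is bounded by a polynomial. -/
def PolyBounded (t : ℕ → ℕ) : Prop := ∃ P : Polynomial ℕ, ∀ m, t m ≤ P.eval m

/-- The class VP over `F`: families of polynomials whose number of variables, degree and circuit
size are polynomially bounded in the index. -/
def IsVP {F : Type*} [CommSemiring F] (n : ℕ → ℕ) (f : ∀ m, MvPolynomial (Fin (n m)) F) : Prop :=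
  PolyBounded n ∧ PolyBounded (fun m => (f m).totalDegree) ∧
    ∃ s : ℕ → ℕ, PolyBounded s ∧ ∀ m, HasCircuitOfSize (f m) (s m)

/-!
# Factors of polynomials with small circuits have small circuits

All circuits are built over `F` itself: no roots or extensions of `F` occur. The heart is a Hensel
lifting that is linear over `F` (`Polynomial.straightLine_coeff_of_mul`).

Let `g` be a prime factor of multiplicity one, `f = g * h`. For points `a`, `b` of `F ^ n` the
polynomial `f (a + t (x - a) + y b)` is a polynomial in `t`, `y` whose coefficients are polynomials
in `x`; by interpolation, these are linear combinations of few affine substitutions into `f`. At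
`t = 0` it is the univariate polynomial `f (a + y b)` over `F`. Writing `fᵢ`, `gᵢ`, `hᵢ` for the
coefficients of `t ^ i` of `f`, `g`, `h`, we have
`g₀ * hᵢ + h₀ * gᵢ = fᵢ - ∑ gⱼ * hᵢ₋ⱼ` with `0 < j < i`, where `g₀`, `h₀` have coefficients in `F`.
If the resultant of `g₀` and `h₀` is not zero, then this linear system for the coefficients of `gᵢ`
and `hᵢ` is solved by a matrix over `F`, whose entries are free constants. Thus all `gᵢ` are
computed one after the other, and `t = 1`, `y = 0` gives back `g`. Good `a` and `b` exist
(`MvPolynomial.exists_resultant_ne_zero`): `b` has to avoid the zeros of the leading form of `g`,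
and `a` those of the resultant of `g (x + y b)` and `h (x + y b)`, which is a nonzero polynomial of
degree at most `(deg f) ^ 2`; a field of characteristic `0` or larger than that has enough elements.

An irreducible factor `g` of multiplicity `e` of `f` is a factor of multiplicity one of an
`(e - 1)`-st partial derivative of `f`, because the characteristic is `0` or larger than `deg f`
(`MvPolynomial.exists_iterate_pderiv_eq_mul`), and these derivatives are again obtained by
interpolation. An arbitrary factor is a product of at most `deg f` irreducible ones.

The recursion reuses intermediate results, so sizes are counted for computations of sets of
polynomials (`StraightLine`), which are then translated from and to circuits.
-/

/-! ### Straight-line computations -/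

/-- `StraightLine B s A`: every element of `A` is obtained from elements of `B` by at most `s`
binary additions and multiplications in total, where intermediate results may be reused. -/
inductive StraightLine {R : Type*} [CommSemiring R] : Set R → ℕ → Set R → Prop
  | of_subset {B A : Set R} {s : ℕ} (h : A ⊆ B) : StraightLine B s A
  | add {B A : Set R} {s : ℕ} {p q : R} (hp : p ∈ B) (hq : q ∈ B)
      (h : StraightLine (insert (p + q) B) s A) : StraightLine B (s + 1) A
  | mul {B A : Set R} {s : ℕ} {p q : R} (hp : p ∈ B) (hq : q ∈ B)
      (h : StraightLine (insert (p * q) B) s A) : StraightLine B (s + 1) A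

namespace StraightLine

section Semiring

variable {R S ι : Type*} [CommSemiring R] [CommSemiring S] {A A' B B' : Set R} {s s' c : ℕ}

theorem mono (h : StraightLine B s A) (hB : B ⊆ B') (hA : A' ⊆ A) (hs : s ≤ s') :
    StraightLine B' s' A' := by
  induction h generalizing B' s' with
  | of_subset h => exact .of_subset (hA.trans (h.trans hB))
  | add hp hq _ ih =>
    obtain ⟨t, rfl⟩ := Nat.exists_eq_add_of_lt hs
    exact .add (hB hp) (hB hq) (ih (Set.insert_subset_insert hB) hA (by omega))
  | mul hp hq _ ih =>
    obtain ⟨t, rfl⟩ := Nat.exists_eq_add_of_lt hs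
    exact .mul (hB hp) (hB hq) (ih (Set.insert_subset_insert hB) hA (by omega))

theorem mono_base (h : StraightLine B s A) (hB : B ⊆ B') : StraightLine B' s A :=
  h.mono hB subset_rfl le_rfl

theorem mono_cost (h : StraightLine B s A) (hs : s ≤ s') : StraightLine B s' A :=
  h.mono subset_rfl subset_rfl hs

theorem trans (h : StraightLine B s A) (h' : StraightLine (B ∪ A) s' A') :
    StraightLine B (s + s') A' := by
  induction h with
  | of_subset h => exact h'.mono (Set.union_subset subset_rfl h) subset_rfl (by omega)
  | add hp hq _ ih =>
    rw [Nat.add_right_comm]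
    exact .add hp hq (ih (h'.mono_base (Set.union_subset_union_left _ (Set.subset_insert _ _))))
  | mul hp hq _ ih =>
    rw [Nat.add_right_comm]
    exact .mul hp hq (ih (h'.mono_base (Set.union_subset_union_left _ (Set.subset_insert _ _))))

theorem union_base (h : StraightLine B s A) : StraightLine B s (B ∪ A) := by
  induction h with
  | of_subset h => exact .of_subset (Set.union_subset subset_rfl h)
  | add hp hq _ ih =>
    exact .add hp hq (ih.mono subset_rfl (Set.union_subset_union_left _ (Set.subset_insert _ _))
      le_rfl)
  | mul hp hq _ ih =>
    exact .mul hp hq (ih.mono subset_rfl (Set.union_subset_union_left _ (Set.subset_insert _ _))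
      le_rfl)

theorem union (h : StraightLine B s A) (h' : StraightLine B s' A') :
    StraightLine B (s + s') (A ∪ A') :=
  h.trans (((h'.mono_base Set.subset_union_left).union_base).mono subset_rfl
    (Set.union_subset_union_left _ Set.subset_union_right) le_rfl)

/-- Ring homomorphisms carry straight-line computations to straight-line computations. -/
theorem map (h : StraightLine B s A) (φ : R →+* S) : StraightLine (φ '' B) s (φ '' A) := by
  induction h with
  | of_subset h => exact .of_subset (Set.image_mono h)
  | add hp hq _ ih =>
    refine .add (Set.mem_image_of_mem φ hp) (Set.mem_image_of_mem φ hq) ?_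
    rwa [← map_add, ← Set.image_insert_eq]
  | mul hp hq _ ih =>
    refine .mul (Set.mem_image_of_mem φ hp) (Set.mem_image_of_mem φ hq) ?_
    rwa [← map_mul, ← Set.image_insert_eq]

theorem singleton_add {p q : R} (hp : p ∈ B) (hq : q ∈ B) : StraightLine B 1 {p + q} :=
  .add hp hq (.of_subset (by simp))

theorem singleton_mul {p q : R} (hp : p ∈ B) (hq : q ∈ B) : StraightLine B 1 {p * q} :=
  .mul hp hq (.of_subset (by simp))

theorem add_add {p q : R} (hp : StraightLine B s {p}) (hq : StraightLine B s' {q}) :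
    StraightLine B (s + s' + 1) {p + q} :=
  (hp.union hq).trans (singleton_add (by simp) (by simp))

theorem mul_mul {p q : R} (hp : StraightLine B s {p}) (hq : StraightLine B s' {q}) :
    StraightLine B (s + s' + 1) {p * q} :=
  (hp.union hq).trans (singleton_mul (by simp) (by simp))

theorem biUnion (I : Finset ι) (A : ι → Set R) (h : ∀ i ∈ I, StraightLine B c (A i)) :
    StraightLine B (I.card * c) (⋃ i ∈ I, A i) := by
  classical
  induction I using Finset.induction_on with
  | empty => exact .of_subset (by simp)
  | insert i I hi ih =>
    rw [Finset.set_biUnion_insert, Finset.card_insert_of_notMem hi, Nat.add_one_mul, add_comm]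
    exact (h i (by simp)).union (ih fun j hj => h j (by simp [hj]))

theorem sum (I : Finset ι) (p : ι → R) (h0 : (0 : R) ∈ B)
    (h : ∀ i ∈ I, StraightLine B c {p i}) :
    StraightLine B (I.card * (c + 1)) {∑ i ∈ I, p i} := by
  classical
  induction I using Finset.induction_on with
  | empty => exact .of_subset (by simpa)
  | insert i I hi ih =>
    rw [Finset.sum_insert hi, Finset.card_insert_of_notMem hi]
    exact ((h i (by simp)).add_add (ih fun j hj => h j (by simp [hj]))).mono_cost
      (le_of_eq (by ring))

theorem multiset_sum (M : Multiset R) (h0 : (0 : R) ∈ B) (h : ∀ p ∈ M, p ∈ B) :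
    StraightLine B M.card {M.sum} := by
  induction M using Multiset.induction_on with
  | empty => exact .of_subset (by simpa)
  | cons p M ih =>
    rw [Multiset.sum_cons, Multiset.card_cons]
    have hp : StraightLine B 0 {p} := .of_subset (by simpa using h p (by simp))
    exact (hp.add_add (ih fun q hq => h q (by simp [hq]))).mono_cost (by omega)

theorem multiset_prod (M : Multiset R) (h1 : (1 : R) ∈ B) (h : ∀ p ∈ M, p ∈ B) :
    StraightLine B M.card {M.prod} := by
  induction M using Multiset.induction_on with
  | empty => exact .of_subset (by simpa)
  | cons p M ih =>
    rw [Multiset.prod_cons, Multiset.card_cons]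
    have hp : StraightLine B 0 {p} := .of_subset (by simpa using h p (by simp))
    exact (hp.mul_mul (ih fun q hq => h q (by simp [hq]))).mono_cost (by omega)

/-- Sets that can be computed one after the other, each at cost `c` from the previous ones. -/
theorem iterate (A : ℕ → Set R) (N : ℕ)
    (h : ∀ k < N, StraightLine (B ∪ ⋃ i ∈ Finset.range k, A i) c (A k)) :
    StraightLine B (N * c) (⋃ i ∈ Finset.range N, A i) := by
  induction N with
  | zero => exact .of_subset (by simp)
  | succ N ih =>
    rw [Nat.add_one_mul, Finset.range_add_one, Finset.set_biUnion_insert]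
    refine (ih fun k hk => h k (by omega)).trans ((h N (by omega)).union_base.mono subset_rfl ?_
      le_rfl)
    rw [Set.union_comm]
    exact Set.union_subset_union_left _ Set.subset_union_right

end Semiring

/-- A linear combination, with coefficients that are available for free, of elements of cost `c`. -/
theorem sum_mul {R ι : Type*} [CommSemiring R] {B : Set R} {c : ℕ} (I : Finset ι) (a p : ι → R)
    (h0 : (0 : R) ∈ B) (ha : ∀ i ∈ I, a i ∈ B) (h : ∀ i ∈ I, StraightLine B c {p i}) :
    StraightLine B (I.card * (c + 2)) {∑ i ∈ I, a i * p i} := by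
  refine sum I _ h0 fun i hi => ?_
  have : StraightLine B 0 {a i} := .of_subset (by simpa using ha i hi)
  exact (this.mul_mul (h i hi)).mono_cost (by omega)

end StraightLine

/-! ### Circuits and straight-line computations -/

/-- The polynomials at the gates of in-degree zero: variables and constants. -/
def circuitInputs (F : Type*) [CommSemiring F] (n : ℕ) : Set (MvPolynomial (Fin n) F) :=
  Set.range MvPolynomial.X ∪ Set.range MvPolynomial.C

theorem X_mem_circuitInputs {F : Type*} [CommSemiring F] {n : ℕ} (i : Fin n) :
    MvPolynomial.X i ∈ circuitInputs F n := Or.inl ⟨i, rfl⟩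

theorem C_mem_circuitInputs {F : Type*} [CommSemiring F] {n : ℕ} (c : F) :
    MvPolynomial.C c ∈ circuitInputs F n := Or.inr ⟨c, rfl⟩

namespace ArithCircuit

variable {F : Type*} {n : ℕ}

section

variable [CommSemiring F] (C : ArithCircuit F n) (i : Fin C.numGates)

theorem gatePoly_of_label_var {k : Fin n} (h : C.label i = .var k) :
    C.gatePoly i = MvPolynomial.X k := by
  rw [gatePoly, h]

theorem gatePoly_of_label_const {c : F} (h : C.label i = .const c) :
    C.gatePoly i = MvPolynomial.C c := by
  rw [gatePoly, h]

theorem gatePoly_of_label_sum (h : C.label i = .sum) :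
    C.gatePoly i = ((C.preds i).map C.gatePoly).sum := by
  rw [gatePoly, h]
  exact congrArg Multiset.sum (Multiset.attach_map_val' _ _)

theorem gatePoly_of_label_prod (h : C.label i = .prod) :
    C.gatePoly i = ((C.preds i).map C.gatePoly).prod := by
  rw [gatePoly, h]
  exact congrArg Multiset.prod (Multiset.attach_map_val' _ _)

end

theorem straightLine_gatePoly [CommSemiring F] (C : ArithCircuit F n) :
    StraightLine (circuitInputs F n) C.size (Set.range C.gatePoly) := by
  have key : ∀ m ≤ C.numGates, StraightLine (circuitInputs F n)
      (∑ i with i.val < m, (C.preds i).card) (C.gatePoly '' {i | i.val < m}) := by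
    intro m
    induction m with
    | zero => intro _; exact .of_subset (by simp)
    | succ m ih =>
      intro hm
      let g : Fin C.numGates := ⟨m, hm⟩
      have hset : {i : Fin C.numGates | i.val < m + 1} = {i | i.val < m} ∪ {g} := by
        ext i; simp [g, Fin.ext_iff]; omega
      have hfin : (Finset.univ.filter fun i : Fin C.numGates => i.val < m + 1) =
          insert g (Finset.univ.filter fun i => i.val < m) := by
        ext i; simp [g, Fin.ext_iff]; omega
      rw [hset, hfin, Finset.sum_insert (by simp [g]), add_comm, Set.image_union,
        Set.image_singleton]
      have h0 : ∀ c : F, MvPolynomial.C c ∈ circuitInputs F n ∪ C.gatePoly '' {i | i.val < m} :=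
        fun c => Or.inl (C_mem_circuitInputs c)
      have hpred : ∀ p ∈ (C.preds g).map C.gatePoly,
          p ∈ circuitInputs F n ∪ C.gatePoly '' {i | i.val < m} := by
        intro p hp
        obtain ⟨j, hj, rfl⟩ := Multiset.mem_map.1 hp
        exact Or.inr ⟨j, C.acyclic g j hj, rfl⟩
      have hstep : StraightLine (circuitInputs F n ∪ C.gatePoly '' {i | i.val < m})
          (C.preds g).card {C.gatePoly g} := by
        cases hl : C.label g with
        | var k =>
          rw [C.gatePoly_of_label_var g hl]
          exact .of_subset (by simp [X_mem_circuitInputs])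
        | const c =>
          rw [C.gatePoly_of_label_const g hl]
          exact .of_subset (by simpa using h0 c)
        | sum =>
          rw [C.gatePoly_of_label_sum g hl]
          simpa using StraightLine.multiset_sum _ (by simpa using h0 0) hpred
        | prod =>
          rw [C.gatePoly_of_label_prod g hl]
          simpa using StraightLine.multiset_prod _ (by simpa using h0 1) hpred
      exact (ih (by omega)).trans (hstep.union_base.mono subset_rfl
        (Set.union_subset_union_left _ Set.subset_union_right) le_rfl)
  refine (key C.numGates le_rfl).mono subset_rfl ?_ ?_
  · rintro _ ⟨i, rfl⟩
    exact ⟨i, i.2, rfl⟩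
  · exact Finset.sum_le_sum_of_subset (Finset.filter_subset _ _)

/-- The circuit without gates. -/
def empty (F : Type*) (n : ℕ) : ArithCircuit F n where
  numGates := 0
  label := Fin.elim0
  preds := Fin.elim0
  acyclic i := i.elim0
  isInput_iff i := i.elim0

/-- Append one gate, with label `l` and predecessors `M`, at the end of a circuit. -/
def snoc (C : ArithCircuit F n) (l : GateLabel F n) (M : Multiset (Fin C.numGates))
    (h : l.IsInput ↔ M = 0) : ArithCircuit F n where
  numGates := C.numGates + 1
  label := Fin.snoc (α := fun _ => GateLabel F n) C.label l
  preds := Fin.snoc (α := fun _ => Multiset (Fin (C.numGates + 1)))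
    (fun i => (C.preds i).map Fin.castSucc) (M.map Fin.castSucc)
  acyclic i j hj := by
    induction i using Fin.lastCases with
    | last =>
      obtain ⟨k, -, rfl⟩ := Multiset.mem_map.1 (by simpa only [Fin.snoc_last] using hj)
      exact Fin.castSucc_lt_last k
    | cast i =>
      obtain ⟨k, hk, rfl⟩ := Multiset.mem_map.1 (by simpa only [Fin.snoc_castSucc] using hj)
      exact Fin.castSucc_lt_castSucc_iff.2 (C.acyclic i k hk)
  isInput_iff i := by
    induction i using Fin.lastCases with
    | last => simpa using h
    | cast i => simpa using C.isInput_iff i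

section Snoc

variable (C : ArithCircuit F n) (l : GateLabel F n) (M : Multiset (Fin C.numGates))
  (h : l.IsInput ↔ M = 0)

theorem size_snoc : (C.snoc l M h).size = C.size + M.card := by
  unfold size
  refine (Fin.sum_univ_castSucc (n := C.numGates) _).trans ?_
  simp [snoc]

theorem snoc_label_castSucc (i : Fin C.numGates) :
    (C.snoc l M h).label i.castSucc = C.label i := by simp [snoc]

theorem snoc_preds_castSucc (i : Fin C.numGates) :
    (C.snoc l M h).preds i.castSucc = (C.preds i).map Fin.castSucc := by simp [snoc]

theorem snoc_label_last : (C.snoc l M h).label (Fin.last _) = l := by simp [snoc]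

theorem snoc_preds_last : (C.snoc l M h).preds (Fin.last _) = M.map Fin.castSucc := by
  simp [snoc]

theorem isOutput_snoc_last : (C.snoc l M h).IsOutput (Fin.last C.numGates) :=
  fun j hj => absurd ((C.snoc l M h).acyclic j _ hj) (Fin.le_last j).not_gt

theorem gatePoly_snoc_castSucc [CommSemiring F] (i : Fin C.numGates) :
    (C.snoc l M h).gatePoly i.castSucc = C.gatePoly i := by
  induction i using WellFoundedLT.induction with
  | ind i ih =>
    have hmap : ((C.snoc l M h).preds i.castSucc).map (C.snoc l M h).gatePoly =
        (C.preds i).map C.gatePoly := by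
      refine (congrArg (Multiset.map _) (C.snoc_preds_castSucc l M h i)).trans
        ((Multiset.map_map _ _ _).trans ?_)
      exact Multiset.map_congr rfl fun j hj => ih j (C.acyclic i j hj)
    have hlab := C.snoc_label_castSucc l M h i
    cases hl : C.label i with
    | var k => rw [gatePoly_of_label_var _ _ hl, gatePoly_of_label_var _ _ (hlab.trans hl)]
    | const c => rw [gatePoly_of_label_const _ _ hl, gatePoly_of_label_const _ _ (hlab.trans hl)]
    | sum => rw [gatePoly_of_label_sum _ _ hl, gatePoly_of_label_sum _ _ (hlab.trans hl), hmap]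
    | prod => rw [gatePoly_of_label_prod _ _ hl, gatePoly_of_label_prod _ _ (hlab.trans hl), hmap]

theorem map_gatePoly_snoc_preds_last [CommSemiring F] :
    ((C.snoc l M h).preds (Fin.last _)).map (C.snoc l M h).gatePoly = M.map C.gatePoly := by
  refine (congrArg (Multiset.map _) (C.snoc_preds_last l M h)).trans
    ((Multiset.map_map _ _ _).trans ?_)
  exact Multiset.map_congr rfl fun j _ => C.gatePoly_snoc_castSucc l M h j

theorem range_gatePoly_subset_snoc [CommSemiring F] :
    Set.range C.gatePoly ⊆ Set.range (C.snoc l M h).gatePoly := by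
  rintro _ ⟨i, rfl⟩
  exact ⟨i.castSucc, C.gatePoly_snoc_castSucc l M h i⟩

end Snoc

variable [CommSemiring F]

theorem exists_of_finset_circuitInputs (B : Finset (MvPolynomial (Fin n) F))
    (hB : (B : Set (MvPolynomial (Fin n) F)) ⊆ circuitInputs F n) :
    ∃ C : ArithCircuit F n, C.size = 0 ∧ (B : Set _) ⊆ Set.range C.gatePoly := by
  classical
  induction B using Finset.induction_on with
  | empty => exact ⟨empty F n, rfl, by simp⟩
  | insert p B _ ih =>
    rw [Finset.coe_insert, Set.insert_subset_iff] at hB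
    obtain ⟨C, hC, hBC⟩ := ih hB.2
    have hext : ∀ (l : GateLabel F n) (hl : l.IsInput ↔ (0 : Multiset (Fin C.numGates)) = 0),
        (C.snoc l 0 hl).gatePoly (Fin.last _) = p →
        ∃ C : ArithCircuit F n, C.size = 0 ∧ ((insert p B : Finset _) : Set _) ⊆
          Set.range C.gatePoly := fun l hl h =>
      ⟨C.snoc l 0 hl, by simp [size_snoc, hC], by
        rw [Finset.coe_insert, Set.insert_subset_iff]
        exact ⟨⟨_, h⟩, hBC.trans (C.range_gatePoly_subset_snoc _ _ _)⟩⟩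
    rcases hB.1 with ⟨k, rfl⟩ | ⟨c, rfl⟩
    · exact hext (.var k) (by simp [GateLabel.IsInput])
        (gatePoly_of_label_var _ _ (snoc_label_last _ _ _ _))
    · exact hext (.const c) (by simp [GateLabel.IsInput])
        (gatePoly_of_label_const _ _ (snoc_label_last _ _ _ _))

/-- A circuit whose gates compute the finite set `B` can be extended to one that computes a finite
subset of what is obtained from `B` by `s` additional operations. -/
theorem exists_of_straightLine {D A : Set (MvPolynomial (Fin n) F)} {s t : ℕ}
    (h : StraightLine D s A)
    (hD : ∀ B : Finset (MvPolynomial (Fin n) F), (B : Set _) ⊆ D →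
      ∃ C : ArithCircuit F n, C.size ≤ t ∧ (B : Set _) ⊆ Set.range C.gatePoly)
    (B : Finset (MvPolynomial (Fin n) F)) (hB : (B : Set _) ⊆ A) :
    ∃ C : ArithCircuit F n, C.size ≤ t + 2 * s ∧ (B : Set _) ⊆ Set.range C.gatePoly := by
  classical
  have hstep : ∀ (D : Set (MvPolynomial (Fin n) F)) (t : ℕ) (p q r : MvPolynomial (Fin n) F)
      (l : GateLabel F n), ¬ l.IsInput → (∀ (C : ArithCircuit F n) (i j : Fin C.numGates) hl,
        C.gatePoly i = p → C.gatePoly j = q → (C.snoc l {i, j} hl).gatePoly (Fin.last _) = r) →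
      p ∈ D → q ∈ D → (∀ B : Finset (MvPolynomial (Fin n) F), (B : Set _) ⊆ D →
      ∃ C : ArithCircuit F n, C.size ≤ t ∧ (B : Set _) ⊆ Set.range C.gatePoly) →
      ∀ B : Finset (MvPolynomial (Fin n) F), (B : Set _) ⊆ insert r D →
      ∃ C : ArithCircuit F n, C.size ≤ t + 2 ∧ (B : Set _) ⊆ Set.range C.gatePoly := by
    intro D t p q r l hl hlr hp hq hD B hB
    obtain ⟨C, hC, hBC⟩ := hD (insert p (insert q (B.erase r))) (by
      intro x hx
      simp only [Finset.coe_insert, Finset.coe_erase, Set.mem_insert_iff, Set.mem_sdiff,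
        Set.mem_singleton_iff, Finset.mem_coe] at hx
      rcases hx with rfl | rfl | ⟨hx, hxr⟩
      · exact hp
      · exact hq
      · exact (hB hx).resolve_left hxr)
    simp only [Finset.coe_insert, Set.insert_subset_iff] at hBC
    obtain ⟨⟨i, hi⟩, ⟨j, hj⟩, hBC⟩ := hBC
    have hl' : l.IsInput ↔ ({i, j} : Multiset (Fin C.numGates)) = 0 := by simp [hl]
    refine ⟨C.snoc l {i, j} hl', by simp [size_snoc, hC], fun x hx => ?_⟩
    by_cases hxr : x = r
    · exact ⟨Fin.last _, by rw [hxr, hlr C i j hl' hi hj]⟩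
    · exact C.range_gatePoly_subset_snoc _ _ _ (hBC (by simp_all))
  induction h generalizing t with
  | of_subset h =>
    obtain ⟨C, hC, hBC⟩ := hD B (hB.trans h)
    exact ⟨C, by omega, hBC⟩
  | @add D A s p q hp hq _ ih =>
    rw [mul_add, mul_one, add_comm (2 * s), ← add_assoc]
    refine ih (hstep D t p q (p + q) .sum (by simp [GateLabel.IsInput]) ?_ hp hq hD) hB
    intro C i j hl hi hj
    rw [gatePoly_of_label_sum _ _ (snoc_label_last _ _ _ _), map_gatePoly_snoc_preds_last]
    simp [hi, hj]
  | @mul D A s p q hp hq _ ih =>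
    rw [mul_add, mul_one, add_comm (2 * s), ← add_assoc]
    refine ih (hstep D t p q (p * q) .prod (by simp [GateLabel.IsInput]) ?_ hp hq hD) hB
    intro C i j hl hi hj
    rw [gatePoly_of_label_prod _ _ (snoc_label_last _ _ _ _), map_gatePoly_snoc_preds_last]
    simp [hi, hj]

end ArithCircuit

theorem HasCircuitOfSize.straightLine {F : Type*} [CommSemiring F] {n s : ℕ}
    {f : MvPolynomial (Fin n) F} (h : HasCircuitOfSize f s) :
    StraightLine (circuitInputs F n) s {f} := by
  obtain ⟨C, ⟨i, -, rfl⟩, hC⟩ := h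
  exact C.straightLine_gatePoly.mono subset_rfl (by simp) hC

/-- The last, unary gate makes sure that `f` is computed at an output gate. -/
theorem StraightLine.hasCircuitOfSize {F : Type*} [CommSemiring F] {n s : ℕ}
    {f : MvPolynomial (Fin n) F} (h : StraightLine (circuitInputs F n) s {f}) :
    HasCircuitOfSize f (2 * s + 1) := by
  obtain ⟨C, hC, hf⟩ := ArithCircuit.exists_of_straightLine (t := 0) h
    (fun B hB => (ArithCircuit.exists_of_finset_circuitInputs B hB).imp fun C h => ⟨h.1.le, h.2⟩)
    {f} (by simp)
  obtain ⟨i, hi⟩ := hf (by simp : f ∈ _)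
  have hl : (GateLabel.sum : GateLabel F n).IsInput ↔ ({i} : Multiset (Fin C.numGates)) = 0 := by
    simp [GateLabel.IsInput]
  refine ⟨C.snoc .sum {i} hl, ⟨Fin.last _, C.isOutput_snoc_last _ _ _, ?_⟩, ?_⟩
  · rw [ArithCircuit.gatePoly_of_label_sum _ _ (ArithCircuit.snoc_label_last _ _ _ _),
      ArithCircuit.map_gatePoly_snoc_preds_last]
    simpa using hi
  · rw [ArithCircuit.size_snoc]
    simpa using hC

/-! ### Interpolation -/

theorem Polynomial.exists_coeff_eq_sum_eval {F : Type*} (R : Type*) [Field F] [CommRing R]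
    [Algebra F R] {N : ℕ} (hN : Set.InjOn (Nat.cast : ℕ → F) (Set.Iio N)) :
    ∃ c : ℕ → ℕ → F, ∀ P : Polynomial R, P.natDegree < N → ∀ k,
      P.coeff k = ∑ j ∈ Finset.range N, algebraMap F R (c k j) * P.eval (algebraMap F R j) := by
  let z : Fin N → F := fun j => (j.val : F)
  have hz : Function.Injective z := fun i j h => Fin.ext (hN i.2 j.2 h)
  let V := Matrix.vandermonde z
  have hV : IsUnit V.det := (Matrix.det_vandermonde_ne_zero_iff.2 hz).isUnit
  refine ⟨fun k j => if h : k < N ∧ j < N then V⁻¹ ⟨k, h.1⟩ ⟨j, h.2⟩ else 0, fun P hP k => ?_⟩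
  by_cases hk : k < N
  · have h1 : ∀ i : Fin N, ∑ j, V⁻¹ ⟨k, hk⟩ j * V j i = if (⟨k, hk⟩ : Fin N) = i then 1 else 0 := by
      intro i
      rw [← Matrix.mul_apply, Matrix.nonsing_inv_mul V hV, Matrix.one_apply]
    rw [Finset.sum_range]
    have h2 : ∀ j : Fin N, algebraMap F R (if h : k < N ∧ j.val < N then
        V⁻¹ ⟨k, h.1⟩ ⟨j, h.2⟩ else 0) * P.eval (algebraMap F R j.val) =
        ∑ i : Fin N, P.coeff i * algebraMap F R (V⁻¹ ⟨k, hk⟩ j * V j i) := by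
      intro j
      rw [dif_pos ⟨hk, j.2⟩, Polynomial.eval_eq_sum_range' hP, Finset.sum_range, Finset.mul_sum]
      refine Finset.sum_congr rfl fun i _ => ?_
      simp only [V, z, Matrix.vandermonde_apply, map_mul, map_pow]
      ring
    rw [Finset.sum_congr rfl fun j _ => h2 j, Finset.sum_comm]
    simp_rw [← Finset.mul_sum, ← map_sum, h1]
    simp [apply_ite]
  · rw [Polynomial.coeff_eq_zero_of_natDegree_lt (by omega)]
    simp [hk]

/-! ### Filtrations by degree -/

/-- A ring homomorphism from a polynomial ring that maps constants into level `0` and variables into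
level `1` of a multiplicative filtration maps polynomials of degree `d` into level `d`. -/
theorem MvPolynomial.map_mem_of_filtration {σ F A : Type*} [CommSemiring F] [CommSemiring A]
    (V : ℕ → AddSubmonoid A) (hV : Monotone V)
    (hmul : ∀ i j, ∀ a ∈ V i, ∀ b ∈ V j, a * b ∈ V (i + j))
    (φ : MvPolynomial σ F →+* A) (hC : ∀ c, φ (C c) ∈ V 0) (hX : ∀ i, φ (X i) ∈ V 1)
    (p : MvPolynomial σ F) : φ p ∈ V p.totalDegree := by
  have hmon : ∀ (s : σ →₀ ℕ) (c : F), φ (monomial s c) ∈ V s.degree := by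
    intro s
    induction s using Finsupp.induction_linear with
    | zero => intro c; simpa using hC c
    | add s t hs ht =>
      intro c
      rw [← mul_one c, ← monomial_mul, map_mul, map_add]
      exact hmul _ _ _ (hs c) _ (ht 1)
    | single i k =>
      intro c
      rw [← C_mul_X_pow_eq_monomial, map_mul, Finsupp.degree_single]
      induction k with
      | zero => simpa using hC c
      | succ k ih =>
        rw [pow_succ, map_mul, ← mul_assoc]
        exact hmul _ _ _ ih _ (hX i)
  rw [p.as_sum, map_sum]
  refine sum_mem fun s hs => hV ?_ (hmon s _)
  rw [← p.as_sum]
  exact le_totalDegree hs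

namespace Polynomial

/-- Bivariate polynomials of total degree at most `d`. -/
def bidegreeLE (R : Type*) [CommSemiring R] (d : ℕ) : AddSubmonoid (Polynomial (Polynomial R)) where
  carrier := {P | ∀ k l, d < k + l → (P.coeff k).coeff l = 0}
  zero_mem' := by simp
  add_mem' hP hQ k l h := by simp [hP k l h, hQ k l h]

theorem bidegreeLE_mono (R : Type*) [CommSemiring R] : Monotone (bidegreeLE R) :=
  fun _ _ h _ hP k l hkl => hP k l (by omega)

theorem mul_mem_bidegreeLE {R : Type*} [CommSemiring R] (i j : ℕ) (P : Polynomial (Polynomial R))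
    (hP : P ∈ bidegreeLE R i) (Q : Polynomial (Polynomial R)) (hQ : Q ∈ bidegreeLE R j) :
    P * Q ∈ bidegreeLE R (i + j) := by
  intro k l h
  rw [coeff_mul, finsetSum_coeff]
  refine Finset.sum_eq_zero fun x hx => ?_
  rw [coeff_mul]
  refine Finset.sum_eq_zero fun y hy => ?_
  rw [Finset.HasAntidiagonal.mem_antidiagonal] at hx hy
  by_cases hi : i < x.1 + y.1
  · rw [hP _ _ hi, zero_mul]
  · rw [hQ _ _ (by omega), mul_zero]

theorem natDegree_coeff_le_of_mem_bidegreeLE {R : Type*} [CommSemiring R] {d : ℕ}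
    {P : Polynomial (Polynomial R)} (hP : P ∈ bidegreeLE R d) (k : ℕ) :
    (P.coeff k).natDegree ≤ d - k :=
  natDegree_le_iff_coeff_eq_zero.2 fun l hl => hP k l (by omega)

/-- Polynomials of degree at most `d` whose coefficients have total degree at most `d`. -/
def coeffDegreeLE (σ F : Type*) [CommSemiring F] (d : ℕ) :
    AddSubmonoid (Polynomial (MvPolynomial σ F)) where
  carrier := {P | P.natDegree ≤ d ∧ ∀ l, (P.coeff l).totalDegree ≤ d}
  zero_mem' := by simp
  add_mem' hP hQ := by
    refine ⟨natDegree_add_le_of_degree_le hP.1 hQ.1, fun l => ?_⟩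
    rw [coeff_add]
    exact (MvPolynomial.totalDegree_add _ _).trans (max_le (hP.2 l) (hQ.2 l))

theorem coeffDegreeLE_mono (σ F : Type*) [CommSemiring F] : Monotone (coeffDegreeLE σ F) :=
  fun _ _ h _ hP => ⟨hP.1.trans h, fun l => (hP.2 l).trans h⟩

theorem mul_mem_coeffDegreeLE {σ F : Type*} [CommSemiring F] (i j : ℕ)
    (P : Polynomial (MvPolynomial σ F)) (hP : P ∈ coeffDegreeLE σ F i)
    (Q : Polynomial (MvPolynomial σ F)) (hQ : Q ∈ coeffDegreeLE σ F j) :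
    P * Q ∈ coeffDegreeLE σ F (i + j) := by
  refine ⟨natDegree_mul_le_of_le hP.1 hQ.1, fun l => ?_⟩
  rw [coeff_mul]
  exact MvPolynomial.totalDegree_finsetSum_le fun x _ =>
    (MvPolynomial.totalDegree_mul _ _).trans (add_le_add (hP.2 _) (hQ.2 _))

/-! ### The Sylvester matrix -/

theorem sylvester_mulVec {R : Type*} [CommRing R] {m n : ℕ} {f g : Polynomial R}
    (hf : f.natDegree ≤ m) (hg : g.natDegree ≤ n) {p q : Polynomial R} (hp : p.degree < m)
    (hq : q.degree < n) (l : Fin (m + n)) :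
    (sylvester f g m n).mulVec
      (Fin.append (fun i : Fin m => p.coeff i) fun i : Fin n => q.coeff i) l =
      (f * q + g * p).coeff l := by
  let x : degreeLT R m × degreeLT R n := (⟨p, mem_degreeLT.2 hp⟩, ⟨q, mem_degreeLT.2 hq⟩)
  have h := congrFun (LinearMap.toMatrix_mulVec_repr
    (((degreeLT.basis R m).prod (degreeLT.basis R n)).reindex finSumFinEquiv)
    (degreeLT.basis R (m + n)) (sylvesterMap f g hf hg) x) l
  rw [toMatrix_sylvesterMap'] at h
  rw [degreeLT.basis_repr] at h
  refine Eq.trans ?_ h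
  congr 1
  ext i
  induction i using Fin.addCases <;> simp [x]

/-- If the Sylvester matrix over the field `F` is invertible, then the coefficients of `p` and `q`
are fixed `F`-linear combinations of the coefficients of `f * q + g * p`, also when `p` and `q`
have coefficients in an `F`-algebra. -/
theorem exists_coeff_eq_sum_of_resultant_ne_zero {F : Type*} (R : Type*) [Field F] [CommRing R]
    [Algebra F R] {m n : ℕ} {f g : Polynomial F} (hf : f.natDegree ≤ m) (hg : g.natDegree ≤ n)
    (h : f.resultant g m n ≠ 0) :
    ∃ c : Fin (m + n) → Fin (m + n) → F, ∀ p q : Polynomial R, p.degree < m → q.degree < n →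
      ∀ i : Fin (m + n), Fin.append (fun i : Fin m => p.coeff i) (fun i : Fin n => q.coeff i) i =
        ∑ l : Fin (m + n), algebraMap F R (c i l) *
          (f.map (algebraMap F R) * q + g.map (algebraMap F R) * p).coeff l := by
  let M := sylvester f g m n
  refine ⟨fun i l => (M⁻¹ : Matrix (Fin (m + n)) (Fin (m + n)) F) i l, fun p q hp hq i => ?_⟩
  have hM : M⁻¹.map (algebraMap F R) * M.map (algebraMap F R) = 1 := by
    rw [← Matrix.map_mul, Matrix.nonsing_inv_mul M (Ne.isUnit h)]
    exact Matrix.map_one _ (map_zero _) (map_one _)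
  have hMR : M.map (algebraMap F R) =
      sylvester (f.map (algebraMap F R)) (g.map (algebraMap F R)) m n :=
    (sylvester_map_map f g m n (algebraMap F R)).symm
  simp_rw [← sylvester_mulVec (natDegree_map_le.trans hf) (natDegree_map_le.trans hg) hp hq, ← hMR]
  conv_lhs => rw [← Matrix.one_mulVec (Fin.append (fun i : Fin m => p.coeff i)
    fun i : Fin n => q.coeff i), ← hM, ← Matrix.mulVec_mulVec]
  simp only [Matrix.mulVec, dotProduct, Matrix.map_apply]

theorem resultant_ne_zero_of_prime {R : Type*} [CommRing R] [IsDomain R] {m n : ℕ}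
    {f g : Polynomial R} (hf : Prime f) (hfm : f.natDegree = m) (hg : g.natDegree ≤ n)
    (h : ¬ f ∣ g) : f.resultant g m n ≠ 0 := by
  intro h0
  obtain ⟨v, hv0, hv⟩ := Matrix.exists_mulVec_eq_zero_iff.2 h0
  apply hv0
  let p := (degreeLT.basis R m).equivFun.symm fun i => v (Fin.castAdd n i)
  let q := (degreeLT.basis R n).equivFun.symm fun i => v (Fin.natAdd m i)
  have hp : ∀ i : Fin m, (p : Polynomial R).coeff i = v (Fin.castAdd n i) := fun i => by
    rw [← degreeLT.basis_repr, ← Module.Basis.equivFun_apply, LinearEquiv.apply_symm_apply]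
  have hq : ∀ i : Fin n, (q : Polynomial R).coeff i = v (Fin.natAdd m i) := fun i => by
    rw [← degreeLT.basis_repr, ← Module.Basis.equivFun_apply, LinearEquiv.apply_symm_apply]
  have hpd := mem_degreeLT.1 p.2
  have hqd := mem_degreeLT.1 q.2
  have hv' : v = Fin.append (fun i : Fin m => (p : Polynomial R).coeff i)
      fun i : Fin n => (q : Polynomial R).coeff i := by
    ext i
    induction i using Fin.addCases <;> simp [hp, hq]
  have hsum : f * q + g * p = 0 := by
    ext l
    by_cases hl : l < m + n
    · have := congrFun hv ⟨l, hl⟩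
      rw [hv', sylvester_mulVec hfm.le hg hpd hqd] at this
      exact this
    · have hmem := (sylvesterMap f g hfm.le hg (p, q)).2
      rw [mem_degreeLT] at hmem
      exact coeff_eq_zero_of_degree_lt (hmem.trans_le (by exact_mod_cast not_lt.1 hl))
  have hp0 : (p : Polynomial R) = 0 := by
    have hdvd : f ∣ g * p := ⟨-q, by linear_combination hsum⟩
    refine eq_zero_of_dvd_of_degree_lt ((hf.dvd_or_dvd hdvd).resolve_left h) ?_
    rwa [degree_eq_natDegree hf.ne_zero, hfm]
  have hq0 : (q : Polynomial R) = 0 := by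
    rw [hp0, mul_zero, add_zero] at hsum
    exact (mul_eq_zero.1 hsum).resolve_left hf.ne_zero
  rw [hv']
  ext i
  induction i using Fin.addCases <;> simp [hp0, hq0]

end Polynomial

/-! ### Hensel lifting -/

/-- The cost of Hensel lifting for a product of bidegree `d`. -/
def henselCost {A : Type*} [CommSemiring A] (d : A) : A :=
  (d + 1) * (d * ((d + 1) * ((d + 1) * 2 + 1) + 2) + d * (d * 2))

namespace Polynomial

theorem coeff_mul_eq_add_sum_filter {S : Type*} [CommSemiring S] (P Q : Polynomial S) {i : ℕ}
    (hi : i ≠ 0) :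
    (P * Q).coeff i = P.coeff 0 * Q.coeff i + Q.coeff 0 * P.coeff i +
      ∑ x ∈ (Finset.HasAntidiagonal.antidiagonal i).filter (fun x => x.1 ≠ 0 ∧ x.2 ≠ 0),
        P.coeff x.1 * Q.coeff x.2 := by
  have hf : (Finset.HasAntidiagonal.antidiagonal i).filter (fun x => ¬(x.1 ≠ 0 ∧ x.2 ≠ 0)) =
      {(0, i), (i, 0)} := by
    ext ⟨a, b⟩
    simp only [Finset.mem_filter, Finset.HasAntidiagonal.mem_antidiagonal, Finset.mem_insert,
      Finset.mem_singleton, Prod.mk.injEq]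
    omega
  rw [coeff_mul, ← Finset.sum_filter_not_add_sum_filter _ (fun x => x.1 ≠ 0 ∧ x.2 ≠ 0), hf,
    Finset.sum_pair (by simpa using fun h => absurd h.symm hi), mul_comm (Q.coeff 0)]

/-- Hensel lifting. If the constant coefficients of `P` and `Q` have coefficients in the field `F`
and invertible Sylvester matrix, then the coefficients of `P` can be computed from those of
`P * Q`: the `i`-th coefficients `p`, `q` of `P`, `Q` satisfy
`P₀ * q + Q₀ * p = (P * Q)ᵢ - (terms with smaller index)`, a linear system over `F`. -/
theorem straightLine_coeff_of_mul {F R : Type*} [Field F] [CommRing R] [Nontrivial R] [Algebra F R]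
    {m n : ℕ} {P Q : Polynomial (Polynomial R)} (hP : P ∈ bidegreeLE R m) (hQ : Q ∈ bidegreeLE R n)
    {g h : Polynomial F} (hg : P.coeff 0 = g.map (algebraMap F R))
    (hh : Q.coeff 0 = h.map (algebraMap F R)) (hres : g.resultant h m n ≠ 0) {B : Set R}
    (hB : ∀ c, algebraMap F R c ∈ B) (hPQ : ∀ i j, ((P * Q).coeff i).coeff j ∈ B) :
    StraightLine B (henselCost (m + n)) {x | ∃ i j, x = (P.coeff i).coeff j} := by
  have hinj : Function.Injective (algebraMap F R) := (algebraMap F R).injective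
  have hgm : g.natDegree ≤ m := by
    rw [← natDegree_map_eq_of_injective hinj g, ← hg]
    simpa using natDegree_coeff_le_of_mem_bidegreeLE hP 0
  have hhn : h.natDegree ≤ n := by
    rw [← natDegree_map_eq_of_injective hinj h, ← hh]
    simpa using natDegree_coeff_le_of_mem_bidegreeLE hQ 0
  obtain ⟨c, hc⟩ := exists_coeff_eq_sum_of_resultant_ne_zero R hgm hhn hres
  have h0 : (0 : R) ∈ B := by simpa using hB 0
  let A : ℕ → Set R := fun i => {x | ∃ j, x = (P.coeff i).coeff j ∨ x = (Q.coeff i).coeff j}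
  have hstep : ∀ i < m + n + 1, StraightLine (B ∪ ⋃ k ∈ Finset.range i, A k)
      ((m + n) * ((m + n + 1) * ((m + n + 1) * 2 + 1) + 2) + (m + n) * ((m + n) * 2)) (A i) := by
    intro i hi
    obtain rfl | hi0 := Nat.eq_zero_or_pos i
    · refine .of_subset ?_
      rintro _ ⟨j, rfl | rfl⟩
      · rw [hg, coeff_map]
        exact Or.inl (hB _)
      · rw [hh, coeff_map]
        exact Or.inl (hB _)
    -- the right hand side of the linear system for the `i`-th coefficients
    let r : ℕ → R := fun l => ((P * Q).coeff i).coeff l + algebraMap F R (-1) *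
      ∑ x ∈ (Finset.HasAntidiagonal.antidiagonal i).filter (fun x => x.1 ≠ 0 ∧ x.2 ≠ 0),
        ∑ y ∈ Finset.HasAntidiagonal.antidiagonal l,
          (P.coeff x.1).coeff y.1 * (Q.coeff x.2).coeff y.2
    have hr : ∀ l, (g.map (algebraMap F R) * Q.coeff i + h.map (algebraMap F R) * P.coeff i).coeff l
        = r l := by
      intro l
      simp only [r, coeff_mul_eq_add_sum_filter P Q hi0.ne', coeff_add, finsetSum_coeff, ← hg, ← hh,
        map_neg, map_one, coeff_mul (P.coeff _) (Q.coeff _)]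
      ring
    have hpdeg : (P.coeff i).degree < m := by
      rw [degree_lt_iff_coeff_zero]
      exact fun l hl => hP i l (by omega)
    have hqdeg : (Q.coeff i).degree < n := by
      rw [degree_lt_iff_coeff_zero]
      exact fun l hl => hQ i l (by omega)
    let v : Fin (m + n) → R := Fin.append (fun l : Fin m => (P.coeff i).coeff l)
      (fun l : Fin n => (Q.coeff i).coeff l)
    have hv : ∀ l, v l = ∑ l', algebraMap F R (c l l') * r l' := fun l => by
      simp only [v, hc _ _ hpdeg hqdeg l, hr]
    have hvl : ∀ l : Fin m, v (Fin.castAdd n l) = (P.coeff i).coeff l := Fin.append_left _ _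
    have hvr : ∀ l : Fin n, v (Fin.natAdd m l) = (Q.coeff i).coeff l := Fin.append_right _ _
    have hmem : ∀ k < i, ∀ j, (P.coeff k).coeff j ∈ B ∪ ⋃ k ∈ Finset.range i, A k := fun k hk j =>
      Or.inr (Set.mem_biUnion (Finset.mem_coe.2 (Finset.mem_range.2 hk)) ⟨j, Or.inl rfl⟩)
    have hmem' : ∀ k < i, ∀ j, (Q.coeff k).coeff j ∈ B ∪ ⋃ k ∈ Finset.range i, A k := fun k hk j =>
      Or.inr (Set.mem_biUnion (Finset.mem_coe.2 (Finset.mem_range.2 hk)) ⟨j, Or.inr rfl⟩)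
    have hrcost : ∀ l < m + n, StraightLine (B ∪ ⋃ k ∈ Finset.range i, A k)
        ((m + n + 1) * ((m + n + 1) * 2 + 1) + 2) {r l} := by
      intro l hl
      have hsum := StraightLine.sum (B := B ∪ ⋃ k ∈ Finset.range i, A k) (c := (m + n + 1) * 2)
        ((Finset.HasAntidiagonal.antidiagonal i).filter (fun x => x.1 ≠ 0 ∧ x.2 ≠ 0))
        (fun x => ∑ y ∈ Finset.HasAntidiagonal.antidiagonal l,
          (P.coeff x.1).coeff y.1 * (Q.coeff x.2).coeff y.2)
        (Set.mem_union_left _ h0) fun x hx => by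
          rw [Finset.mem_filter, Finset.HasAntidiagonal.mem_antidiagonal] at hx
          refine (StraightLine.sum (c := 1) (Finset.HasAntidiagonal.antidiagonal l) _
            (Set.mem_union_left _ h0) fun y _ =>
            StraightLine.singleton_mul (hmem _ (by omega) _) (hmem' _ (by omega) _)).mono_cost ?_
          rw [Finset.Nat.card_antidiagonal]
          exact Nat.mul_le_mul_right _ (by omega)
      have hneg : StraightLine (B ∪ ⋃ k ∈ Finset.range i, A k) 0 {algebraMap F R (-1)} :=
        .of_subset (Set.singleton_subset_iff.2 (Or.inl (hB _)))
      have hf : StraightLine (B ∪ ⋃ k ∈ Finset.range i, A k) 0 {((P * Q).coeff i).coeff l} :=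
        .of_subset (Set.singleton_subset_iff.2 (Or.inl (hPQ _ _)))
      refine (hf.add_add (hneg.mul_mul hsum)).mono_cost ?_
      have hcard := Finset.card_filter_le (Finset.HasAntidiagonal.antidiagonal i)
        (fun x : ℕ × ℕ => x.1 ≠ 0 ∧ x.2 ≠ 0)
      rw [Finset.Nat.card_antidiagonal] at hcard
      have := Nat.mul_le_mul_right ((m + n + 1) * 2 + 1)
        (hcard.trans (by omega : i + 1 ≤ m + n + 1))
      omega
    have hrall := StraightLine.biUnion (Finset.range (m + n)) (fun l => {r l})
      fun l hl => hrcost l (Finset.mem_range.1 hl)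
    rw [Finset.card_range] at hrall
    refine hrall.trans ?_
    have hvall := StraightLine.biUnion (B := (B ∪ ⋃ k ∈ Finset.range i, A k) ∪
      ⋃ l ∈ Finset.range (m + n), {r l}) (c := (m + n) * 2) Finset.univ (fun l => {v l})
      fun l _ => by
        rw [hv]
        have := StraightLine.sum_mul (B := (B ∪ ⋃ k ∈ Finset.range i, A k) ∪
          ⋃ l ∈ Finset.range (m + n), {r l}) (c := 0) Finset.univ
          (fun l' => algebraMap F R (c l l')) (fun l' : Fin (m + n) => r l')
          (Or.inl (Or.inl h0)) (fun l' _ => Or.inl (Or.inl (hB _))) fun l' _ =>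
          .of_subset (Set.singleton_subset_iff.2 (Or.inr (Set.mem_biUnion
            (Finset.mem_coe.2 (Finset.mem_range.2 l'.2)) rfl)))
        simpa using this
    rw [Finset.card_univ, Fintype.card_fin] at hvall
    refine hvall.union_base.mono subset_rfl ?_ le_rfl
    rintro _ ⟨j, rfl | rfl⟩
    · by_cases hj : j < m
      · exact Or.inr (Set.mem_biUnion (Finset.mem_coe.2 (Finset.mem_univ (Fin.castAdd n ⟨j, hj⟩)))
        (hvl ⟨j, hj⟩).symm)
      · rw [hP i j (by omega)]
        exact Or.inl (Or.inl (Or.inl h0))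
    · by_cases hj : j < n
      · exact Or.inr (Set.mem_biUnion (Finset.mem_coe.2 (Finset.mem_univ (Fin.natAdd m ⟨j, hj⟩)))
        (hvr ⟨j, hj⟩).symm)
      · rw [hQ i j (by omega)]
        exact Or.inl (Or.inl (Or.inl h0))
  refine (StraightLine.iterate A (m + n + 1) hstep).union_base.mono subset_rfl ?_ le_rfl
  rintro _ ⟨i, j, rfl⟩
  by_cases hi : i < m + n + 1
  · exact Or.inr (Set.mem_biUnion (Finset.mem_coe.2 (Finset.mem_range.2 hi)) ⟨j, Or.inl rfl⟩)
  · rw [hP i j (by omega)]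
    exact Or.inl h0

end Polynomial

/-! ### Good lines -/

namespace MvPolynomial

theorem exists_eval_ne_zero_of_totalDegree_lt {σ F : Type*} [Finite σ] [Field F] {N : ℕ}
    (hN : Set.InjOn (Nat.cast : ℕ → F) (Set.Iio N)) {p : MvPolynomial σ F} (hp : p ≠ 0)
    (hd : p.totalDegree < N) : ∃ a : σ → F, eval a p ≠ 0 := by
  classical
  by_contra! h
  refine hp (eq_zero_of_eval_zero_at_prod_finset p
    (fun _ => (Finset.range N).image (Nat.cast : ℕ → F)) (fun i => ?_) fun x _ => h x)
  rw [Finset.card_image_of_injOn (by simpa using hN), Finset.card_range]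
  exact (degreeOf_le_totalDegree p i).trans_lt hd

variable {σ F : Type*} [Field F]

/-- Translation by a multiple of `b`: the polynomial `p (x + y b)` in the new variable `y`. -/
noncomputable def shift (b : σ → F) : MvPolynomial σ F →ₐ[F] Polynomial (MvPolynomial σ F) :=
  aeval fun i => Polynomial.C (X i) + Polynomial.C (C (b i)) * Polynomial.X

theorem shift_X (b : σ → F) (i : σ) :
    shift b (X i) = Polynomial.C (X i) + Polynomial.C (C (b i)) * Polynomial.X := aeval_X _ _

theorem shift_C (b : σ → F) (c : F) : shift b (C c) = Polynomial.C (C c) := algHom_C _ _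

/-- The extension of `shift b` that fixes the new variable. -/
noncomputable def shiftHom (b : σ → F) :
    Polynomial (MvPolynomial σ F) →+* Polynomial (MvPolynomial σ F) :=
  Polynomial.eval₂RingHom (shift b).toRingHom Polynomial.X

theorem shiftHom_C (b : σ → F) (p : MvPolynomial σ F) :
    shiftHom b (Polynomial.C p) = shift b p := Polynomial.eval₂_C _ _

theorem shiftHom_X (b : σ → F) : shiftHom b Polynomial.X = Polynomial.X :=
  Polynomial.eval₂_X _ _

theorem shiftHom_neg_comp (b : σ → F) : (shiftHom (-b)).comp (shiftHom b) = RingHom.id _ := by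
  refine Polynomial.ringHom_ext' (MvPolynomial.ringHom_ext (fun c => ?_) fun i => ?_) ?_
  · simp [shiftHom_C]
  · simp [shiftHom_C, shiftHom_X, shift_X]
    ring
  · simp [shiftHom_X]

/-- `shiftHom b` is an automorphism; its inverse is the translation by `-b`. -/
noncomputable def shiftEquiv (b : σ → F) :
    Polynomial (MvPolynomial σ F) ≃+* Polynomial (MvPolynomial σ F) :=
  RingEquiv.ofRingHom (shiftHom b) (shiftHom (-b)) (by simpa using shiftHom_neg_comp (-b))
    (shiftHom_neg_comp b)

theorem shiftEquiv_C (b : σ → F) (p : MvPolynomial σ F) :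
    shiftEquiv b (Polynomial.C p) = shift b p := shiftHom_C b p

theorem prime_shift (b : σ → F) {p : MvPolynomial σ F} (hp : Prime p) : Prime (shift b p) := by
  rw [← shiftEquiv_C, MulEquiv.prime_iff]
  exact Polynomial.prime_C_iff.2 hp

theorem dvd_of_shift_dvd_shift (b : σ → F) {p q : MvPolynomial σ F}
    (h : shift b p ∣ shift b q) : p ∣ q := by
  rw [← shiftEquiv_C, ← shiftEquiv_C, map_dvd_iff] at h
  simpa using (Polynomial.C_dvd_iff_dvd_coeff _ _).1 h 0

theorem shift_mem_coeffDegreeLE (b : σ → F) (p : MvPolynomial σ F) :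
    shift b p ∈ Polynomial.coeffDegreeLE σ F p.totalDegree := by
  refine map_mem_of_filtration (Polynomial.coeffDegreeLE σ F) (Polynomial.coeffDegreeLE_mono σ F)
    Polynomial.mul_mem_coeffDegreeLE (shift b).toRingHom (fun c => ?_) (fun i => ?_) p
  · refine ⟨?_, fun l => ?_⟩ <;> simp only [AlgHom.toRingHom_eq_coe, RingHom.coe_coe, shift_C]
    · simp
    · rw [Polynomial.coeff_C]
      split_ifs <;> simp
  · refine ⟨?_, fun l => ?_⟩ <;> simp only [AlgHom.toRingHom_eq_coe, RingHom.coe_coe, shift_X]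
    · compute_degree
    · rw [Polynomial.coeff_add, Polynomial.coeff_C, Polynomial.coeff_C_mul_X]
      refine (totalDegree_add _ _).trans (max_le ?_ ?_) <;> split_ifs <;> simp

theorem natDegree_shift_le (b : σ → F) (p : MvPolynomial σ F) :
    (shift b p).natDegree ≤ p.totalDegree := (shift_mem_coeffDegreeLE b p).1

theorem totalDegree_coeff_shift_le (b : σ → F) (p : MvPolynomial σ F) (l : ℕ) :
    ((shift b p).coeff l).totalDegree ≤ p.totalDegree := (shift_mem_coeffDegreeLE b p).2 l

/-- In the direction `b`, the leading coefficient of `p` is the leading form of `p` at `b`. -/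
theorem coeff_map_eval_shift [Finite σ] (b : σ → F) (p : MvPolynomial σ F) (d : ℕ) :
    ((shift b p).map (eval 0)).coeff d = eval b (homogeneousComponent d p) := by
  have h : (Polynomial.mapRingHom (eval (0 : σ → F))).comp (shift b).toRingHom =
      (aeval fun i => Polynomial.C (b i) * Polynomial.X :
        MvPolynomial σ F →ₐ[F] Polynomial F).toRingHom := by
    refine MvPolynomial.ringHom_ext (fun c => ?_) fun i => ?_
    · simp
    · simp [shift_X]
  have h' : (shift b p).map (eval 0) = aeval (fun i => Polynomial.C (b i) * Polynomial.X) p :=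
    RingHom.congr_fun h p
  rw [h', homogeneousComponent_apply, map_sum, aeval_def, eval₂_eq, Polynomial.finsetSum_coeff,
    Finset.sum_filter]
  refine Finset.sum_congr rfl fun s _ => ?_
  have : ∏ i ∈ s.support, (Polynomial.C (b i) * Polynomial.X) ^ s i =
      Polynomial.C (∏ i ∈ s.support, b i ^ s i) * Polynomial.X ^ s.degree := by
    simp_rw [mul_pow, Finset.prod_mul_distrib, Finset.prod_pow_eq_pow_sum, map_prod, map_pow]
    rfl
  rw [this, Polynomial.algebraMap_eq, ← mul_assoc, ← Polynomial.C_mul, Polynomial.coeff_C_mul_X_pow,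
    eval_monomial]
  simp [Finsupp.prod, eq_comm]

theorem exists_coeff_shift_ne_zero [Finite σ] {N : ℕ}
    (hN : Set.InjOn (Nat.cast : ℕ → F) (Set.Iio N)) {p : MvPolynomial σ F} (hp : p ≠ 0)
    (hd : p.totalDegree < N) : ∃ b : σ → F, (shift b p).coeff p.totalDegree ≠ 0 := by
  have hne : homogeneousComponent p.totalDegree p ≠ 0 := by
    obtain ⟨s, hs, hsd⟩ := Finset.exists_mem_eq_sup p.support (support_nonempty.2 hp)
      fun s => s.sum fun _ e => e
    refine fun h0 => mem_support_iff.1 hs ?_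
    have := coeff_homogeneousComponent p.totalDegree p s
    rw [h0, coeff_zero, if_pos] at this
    · exact this.symm
    · exact hsd.symm
  obtain ⟨b, hb⟩ := exists_eval_ne_zero_of_totalDegree_lt hN hne
    ((homogeneousComponent_isHomogeneous _ p).totalDegree_le.trans_lt hd)
  refine ⟨b, fun h => hb ?_⟩
  rw [← coeff_map_eval_shift, Polynomial.coeff_map, h, map_zero]

theorem totalDegree_resultant_le {P Q : Polynomial (MvPolynomial σ F)} {m n d : ℕ}
    (hP : ∀ l, (P.coeff l).totalDegree ≤ d) (hQ : ∀ l, (Q.coeff l).totalDegree ≤ d) :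
    (P.resultant Q m n).totalDegree ≤ (m + n) * d := by
  have hS : ∀ i j, (Polynomial.sylvester P Q m n i j).totalDegree ≤ d := by
    intro i j
    induction j using Fin.addCases <;> simp only [Polynomial.sylvester, Matrix.of_apply,
      Fin.addCases_left, Fin.addCases_right] <;> split_ifs <;> simp [hP, hQ]
  rw [Polynomial.resultant, Matrix.det_apply]
  refine totalDegree_finsetSum_le fun τ _ => ?_
  have hprod : (∏ i, Polynomial.sylvester P Q m n (τ i) i).totalDegree ≤ (m + n) * d :=
    (totalDegree_finsetProd _ _).trans
      ((Finset.sum_le_sum fun i _ => hS _ _).trans (by simp))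
  rcases Int.units_eq_one_or (Equiv.Perm.sign τ) with h | h
  · rwa [h, one_smul]
  · rwa [h, Units.neg_smul, one_smul, totalDegree_neg]

/-- A prime `g` and a polynomial `h` that it does not divide have invertible Sylvester matrix on
some line. -/
theorem exists_resultant_ne_zero [Finite σ] {g h : MvPolynomial σ F} (hg : Prime g)
    (hgh : ¬ g ∣ h) {N : ℕ} (hN : Set.InjOn (Nat.cast : ℕ → F) (Set.Iio N))
    (hd : (g.totalDegree + h.totalDegree) ^ 2 < N) :
    ∃ a b : σ → F, ((shift b g).map (eval a)).resultant ((shift b h).map (eval a))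
      g.totalDegree h.totalDegree ≠ 0 := by
  obtain ⟨b, hb⟩ := exists_coeff_shift_ne_zero hN hg.ne_zero
    (((Nat.le_add_right _ _).trans (Nat.le_self_pow two_ne_zero _)).trans_lt hd)
  have hres := Polynomial.resultant_ne_zero_of_prime (prime_shift b hg)
    (le_antisymm (natDegree_shift_le b g) (Polynomial.le_natDegree_of_ne_zero hb))
    (natDegree_shift_le b h) (fun hdvd => hgh (dvd_of_shift_dvd_shift b hdvd))
  obtain ⟨a, ha⟩ := exists_eval_ne_zero_of_totalDegree_lt hN hres <| by
    refine (totalDegree_resultant_le (d := g.totalDegree + h.totalDegree) (fun l => ?_)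
      fun l => ?_).trans_lt (by rwa [← sq])
    · exact (totalDegree_coeff_shift_le b g l).trans (by omega)
    · exact (totalDegree_coeff_shift_le b h l).trans (by omega)
  exact ⟨a, b, by rwa [Polynomial.resultant_map_map]⟩

end MvPolynomial

/-! ### Deforming a polynomial to its restriction to a line -/

/-- The cost of computing all coefficients of the restriction `lineHom a b f` of a polynomial `f`
of degree `d` in `n` variables with cost `s`. -/
def lineCost {A : Type*} [CommSemiring A] (s n d : A) : A :=
  (d + 1) * (d + 1) * (n * 2 + s) + (d + 1) * (d + 1) * ((d + 1) * ((d + 1) * 2 + 2))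

theorem StraightLine.affine_subst {F : Type*} [CommRing F] {n s : ℕ} {f : MvPolynomial (Fin n) F}
    (h : StraightLine (circuitInputs F n) s {f}) (u v : Fin n → F) :
    StraightLine (circuitInputs F n) (n * 2 + s)
      {MvPolynomial.aeval (fun i => MvPolynomial.C (u i) * MvPolynomial.X i +
        MvPolynomial.C (v i)) f} := by
  let φ : MvPolynomial (Fin n) F →ₐ[F] MvPolynomial (Fin n) F :=
    MvPolynomial.aeval (fun i => MvPolynomial.C (u i) * MvPolynomial.X i + MvPolynomial.C (v i))
  have hvar := StraightLine.biUnion (B := circuitInputs F n) (c := 2) Finset.univ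
    (fun i => {φ (MvPolynomial.X i)}) fun i _ => by
      have hC : ∀ c : F, StraightLine (circuitInputs F n) 0 {MvPolynomial.C c} := fun c =>
        .of_subset (by simp [C_mem_circuitInputs])
      have hX : StraightLine (circuitInputs F n) 0 {MvPolynomial.X i} :=
        .of_subset (by simp [X_mem_circuitInputs])
      simp only [φ, MvPolynomial.aeval_X]
      exact ((hC (u i)).mul_mul hX).add_add (hC (v i))
  rw [Finset.card_univ, Fintype.card_fin] at hvar
  refine hvar.trans ((h.map φ.toRingHom).mono ?_ (by simp [φ]) le_rfl)
  rintro _ ⟨_, ⟨i, rfl⟩ | ⟨c, rfl⟩, rfl⟩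
  · exact Or.inr (Set.mem_biUnion (Finset.mem_coe.2 (Finset.mem_univ i)) rfl)
  · exact Or.inl (by simpa using C_mem_circuitInputs c)

namespace MvPolynomial

variable {σ F : Type*} [Field F]

/-- The bivariate polynomial `p (a + t (x - a) + y b)`, where `t` is the outer variable and `y` the
inner one. At `t = 0` it is the restriction of `p` to the line through `a` with direction `b`, and
at `t = 1`, `y = 0` it is `p` itself. -/
noncomputable def lineHom (a b : σ → F) :
    MvPolynomial σ F →ₐ[F] Polynomial (Polynomial (MvPolynomial σ F)) :=
  aeval fun i => Polynomial.C (Polynomial.C (C (a i)) + Polynomial.C (C (b i)) * Polynomial.X) +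
    Polynomial.C (Polynomial.C (X i - C (a i))) * Polynomial.X

theorem lineHom_X (a b : σ → F) (i : σ) : lineHom a b (X i) =
    Polynomial.C (Polynomial.C (C (a i)) + Polynomial.C (C (b i)) * Polynomial.X) +
      Polynomial.C (Polynomial.C (X i - C (a i))) * Polynomial.X := aeval_X _ _

theorem lineHom_C (a b : σ → F) (c : F) :
    lineHom a b (C c) = Polynomial.C (Polynomial.C (C c)) := algHom_C _ _

theorem lineHom_mem_bidegreeLE (a b : σ → F) (p : MvPolynomial σ F) :
    lineHom a b p ∈ Polynomial.bidegreeLE (MvPolynomial σ F) p.totalDegree := by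
  refine map_mem_of_filtration _ (Polynomial.bidegreeLE_mono _) Polynomial.mul_mem_bidegreeLE
    (lineHom a b).toRingHom (fun c => ?_) (fun i => ?_) p <;> intro k l hkl <;>
    simp only [AlgHom.toRingHom_eq_coe, RingHom.coe_coe, lineHom_C, lineHom_X]
  · rw [Polynomial.coeff_C]
    split_ifs with hk
    · rw [Polynomial.coeff_C, if_neg (by omega)]
    · simp
  · rw [Polynomial.coeff_add, Polynomial.coeff_C, Polynomial.coeff_C_mul_X]
    split_ifs with h1 h2 h2
    · omega
    · simp only [add_zero, Polynomial.coeff_add, Polynomial.coeff_C, Polynomial.coeff_C_mul_X]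
      rw [if_neg (by omega), if_neg (by omega), add_zero]
    · rw [zero_add, Polynomial.coeff_C, if_neg (by omega)]
    · simp

theorem coeff_zero_lineHom (a b : σ → F) (p : MvPolynomial σ F) :
    (lineHom a b p).coeff 0 =
      ((shift b p).map (eval a)).map (algebraMap F (MvPolynomial σ F)) := by
  have h : Polynomial.constantCoeff.comp (lineHom a b).toRingHom =
      (Polynomial.mapRingHom (algebraMap F (MvPolynomial σ F))).comp
        ((Polynomial.mapRingHom (eval a)).comp (shift b).toRingHom) := by
    refine MvPolynomial.ringHom_ext (fun c => ?_) fun i => ?_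
    · simp [algebraMap_eq]
    · simp [lineHom_X, shift_X, algebraMap_eq]
  exact RingHom.congr_fun h p

theorem natDegree_lineHom_le (a b : σ → F) (p : MvPolynomial σ F) :
    (lineHom a b p).natDegree ≤ p.totalDegree :=
  Polynomial.natDegree_le_iff_coeff_eq_zero.2 fun k hk =>
    Polynomial.ext fun l => by
      simpa using lineHom_mem_bidegreeLE a b p k l (by omega)

theorem sum_coeff_lineHom (a b : σ → F) (p : MvPolynomial σ F) :
    ∑ i ∈ Finset.range (p.totalDegree + 1), ((lineHom a b p).coeff i).coeff 0 = p := by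
  have h : (Polynomial.constantCoeff.comp (Polynomial.evalRingHom 1)).comp
      (lineHom a b).toRingHom = RingHom.id _ := by
    refine MvPolynomial.ringHom_ext (fun c => ?_) fun i => ?_
    · simp
    · simp [lineHom_X]
  have h' : ((lineHom a b p).eval 1).coeff 0 = p := RingHom.congr_fun h p
  rw [Polynomial.eval_eq_sum_range' (Nat.lt_succ_of_le (natDegree_lineHom_le a b p)),
    Polynomial.finsetSum_coeff] at h'
  simpa using h'

theorem eval_map_lineHom (a b : σ → F) (p : MvPolynomial σ F) (z w : F) :
    ((lineHom a b p).map (Polynomial.evalRingHom (C w))).eval (C z) =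
      aeval (fun i => C z * X i + C (a i - z * a i + b i * w)) p := by
  have h : (Polynomial.evalRingHom (C z)).comp
      ((Polynomial.mapRingHom (Polynomial.evalRingHom (C w))).comp (lineHom a b).toRingHom) =
      (aeval (fun i => C z * X i + C (a i - z * a i + b i * w)) :
        MvPolynomial σ F →ₐ[F] MvPolynomial σ F).toRingHom := by
    refine MvPolynomial.ringHom_ext (fun c => ?_) fun i => ?_
    · simp
    · simp [lineHom_X]
      ring
  exact RingHom.congr_fun h p

/-- The coefficients of `lineHom a b f` are computed by interpolation in `t` and `y`. -/
theorem straightLine_coeff_lineHom {n s : ℕ} {f : MvPolynomial (Fin n) F}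
    (hN : Set.InjOn (Nat.cast : ℕ → F) (Set.Iio (f.totalDegree + 1)))
    (h : StraightLine (circuitInputs F n) s {f}) (a b : Fin n → F) :
    StraightLine (circuitInputs F n) (lineCost s n f.totalDegree)
      {x | ∃ i j, x = ((lineHom a b f).coeff i).coeff j} := by
  obtain ⟨c, hc⟩ := Polynomial.exists_coeff_eq_sum_eval (MvPolynomial (Fin n) F) hN
  let P := lineHom a b f
  have hP := lineHom_mem_bidegreeLE a b f
  let N := f.totalDegree + 1
  let E : ℕ → ℕ → MvPolynomial (Fin n) F := fun i j =>
    (P.map (Polynomial.evalRingHom (C (j : F)))).eval (C (i : F))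
  have hcoeff : ∀ k l, (P.coeff k).coeff l = ∑ j ∈ Finset.range N, C (c l j) *
      ∑ i ∈ Finset.range N, C (c k i) * E i j := by
    intro k l
    have hk : (P.coeff k).natDegree < N :=
      Nat.lt_succ_of_le ((Polynomial.natDegree_coeff_le_of_mem_bidegreeLE hP k).trans
        (Nat.sub_le _ _))
    rw [hc _ hk]
    refine Finset.sum_congr rfl fun j _ => congrArg _ ?_
    have hj : (P.map (Polynomial.evalRingHom (C (j : F)))).natDegree < N :=
      Nat.lt_succ_of_le (Polynomial.natDegree_map_le.trans (natDegree_lineHom_le a b f))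
    have := hc _ hj k
    rw [Polynomial.coeff_map] at this
    exact this
  have hE := StraightLine.biUnion (B := circuitInputs F n) (c := n * 2 + s)
    (Finset.range N ×ˢ Finset.range N) (fun x => {E x.1 x.2}) fun x _ => by
      simp only [E, P, eval_map_lineHom]
      exact h.affine_subst _ _
  rw [Finset.card_product, Finset.card_range] at hE
  refine hE.trans ?_
  have hall := StraightLine.biUnion (B := circuitInputs F n ∪
    ⋃ x ∈ Finset.range N ×ˢ Finset.range N, {E x.1 x.2}) (c := N * (N * 2 + 2))
    (Finset.range N ×ˢ Finset.range N) (fun x => {(P.coeff x.1).coeff x.2}) fun x _ => by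
      have h0 : (0 : MvPolynomial (Fin n) F) ∈ circuitInputs F n ∪
          ⋃ x ∈ Finset.range N ×ˢ Finset.range N, {E x.1 x.2} :=
        Or.inl (by simpa using C_mem_circuitInputs (n := n) (0 : F))
      rw [hcoeff]
      refine (StraightLine.sum_mul (c := N * 2) _ _ _ h0
        (fun j _ => Or.inl (C_mem_circuitInputs _)) fun j hj => ?_).mono_cost (by simp)
      refine (StraightLine.sum_mul (c := 0) _ _ _ h0
        (fun j _ => Or.inl (C_mem_circuitInputs _)) fun i hi => ?_).mono_cost (by simp)
      exact .of_subset (Set.singleton_subset_iff.2 (Or.inr (Set.mem_biUnion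
        (Finset.mem_coe.2 (Finset.mk_mem_product hi hj)) rfl)))
  rw [Finset.card_product, Finset.card_range] at hall
  refine hall.union_base.mono subset_rfl ?_ le_rfl
  rintro _ ⟨k, l, rfl⟩
  by_cases hkl : k < N ∧ l < N
  · exact Or.inr (Set.mem_biUnion (Finset.mem_coe.2 (Finset.mk_mem_product
      (Finset.mem_range.2 hkl.1) (Finset.mem_range.2 hkl.2))) rfl)
  · rw [hP k l (by omega)]
    exact Or.inl (Or.inl (by simpa using C_mem_circuitInputs (n := n) (0 : F)))

/-- A prime factor of multiplicity one is computed by Hensel lifting along a good line. -/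
theorem straightLine_of_simple_factor {n s : ℕ} {g h : MvPolynomial (Fin n) F} (hg : Prime g)
    (hh : h ≠ 0) (hgh : ¬ g ∣ h)
    (hN : Set.InjOn (Nat.cast : ℕ → F) (Set.Iio ((g * h).totalDegree ^ 2 + 1)))
    (hs : StraightLine (circuitInputs F n) s {g * h}) :
    StraightLine (circuitInputs F n) (lineCost s n (g * h).totalDegree +
      henselCost (g * h).totalDegree + ((g * h).totalDegree + 1)) {g} := by
  have hdeg := totalDegree_mul_of_isDomain hg.ne_zero hh
  obtain ⟨a, b, hab⟩ := exists_resultant_ne_zero hg hgh hN (by rw [← hdeg]; omega)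
  have hline := straightLine_coeff_lineHom (hN.mono (Set.Iio_subset_Iio
    (Nat.add_le_add_right (Nat.le_self_pow two_ne_zero _) 1))) hs a b
  have hhensel := Polynomial.straightLine_coeff_of_mul (B := circuitInputs F n ∪
    {x | ∃ i j, x = ((lineHom a b (g * h)).coeff i).coeff j}) (lineHom_mem_bidegreeLE a b g)
    (lineHom_mem_bidegreeLE a b h) (coeff_zero_lineHom a b g) (coeff_zero_lineHom a b h) hab
    (fun c => Or.inl (C_mem_circuitInputs c)) fun i j => Or.inr ⟨i, j, by rw [map_mul]⟩
  rw [← hdeg] at hhensel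
  refine (hline.trans hhensel.union_base).trans ?_
  conv => enter [3, 1]; rw [← sum_coeff_lineHom a b g]
  refine (StraightLine.sum (c := 0) _ _ ?_ fun i _ => ?_).mono_cost ?_
  · exact Or.inl (by simpa using C_mem_circuitInputs (n := n) (0 : F))
  · exact .of_subset (Set.singleton_subset_iff.2 (Or.inr (Or.inr ⟨i, 0, rfl⟩)))
  · rw [Finset.card_range]
    omega

end MvPolynomial

/-! ### Reducing the multiplicity by differentiation -/

/-- The cost of an iterated partial derivative of a polynomial of degree `d` with cost `s`. -/
def pderivCost {A : Type*} [CommSemiring A] (s n d : A) : A :=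
  (d + 1) * (n * 2 + s + 2) + 1

namespace MvPolynomial

variable {σ F : Type*} [Field F]

theorem totalDegree_pderiv_le (i : σ) (p : MvPolynomial σ F) :
    (pderiv i p).totalDegree ≤ p.totalDegree - 1 := by
  refine Finset.sup_le fun s hs => ?_
  rw [mem_support_iff, coeff_pderiv] at hs
  have := le_totalDegree (mem_support_iff.2 (left_ne_zero_of_mul hs))
  rw [Finsupp.sum_add_index' (fun _ => rfl) (fun _ _ _ => rfl), Finsupp.sum_single_index rfl]
    at this
  omega

theorem totalDegree_iterate_pderiv_le (i : σ) (p : MvPolynomial σ F) (k : ℕ) :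
    ((pderiv i)^[k] p).totalDegree ≤ p.totalDegree := by
  induction k generalizing p with
  | zero => exact le_rfl
  | succ k ih =>
    rw [Function.iterate_succ_apply]
    exact (ih _).trans ((totalDegree_pderiv_le i p).trans (Nat.sub_le _ _))

theorem totalDegree_pos_of_irreducible {p : MvPolynomial σ F} (hp : Irreducible p) :
    0 < p.totalDegree := by
  refine Nat.pos_of_ne_zero fun h => hp.not_isUnit ?_
  rw [totalDegree_eq_zero_iff_eq_C] at h
  have h0 := hp.ne_zero
  rw [h] at h0 ⊢
  exact (Ne.isUnit (C_ne_zero.1 h0)).map C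

/-- In characteristic zero or larger than the degree, an irreducible polynomial does not divide all
of its partial derivatives. -/
theorem exists_not_dvd_pderiv {p : MvPolynomial σ F} (hp : Irreducible p)
    (hF : ∀ k : ℕ, 0 < k → k ≤ p.totalDegree → (k : F) ≠ 0) : ∃ i, ¬ p ∣ pderiv i p := by
  have hpos := totalDegree_pos_of_irreducible hp
  obtain ⟨s, hs, hsd⟩ := Finset.exists_mem_eq_sup p.support (support_nonempty.2 hp.ne_zero)
    fun s => s.sum fun _ e => e
  have hs0 : s ≠ 0 := by
    rintro rfl
    exact hpos.ne' (hsd.trans Finsupp.sum_zero_index)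
  obtain ⟨i, hi⟩ := Finsupp.ne_iff.1 hs0
  have hi' : 1 ≤ s i := Nat.pos_of_ne_zero hi
  have hle : s i ≤ p.totalDegree := by
    refine le_trans ?_ (le_totalDegree hs)
    exact Finset.single_le_sum (f := fun j => s j) (fun _ _ => Nat.zero_le _)
      (Finsupp.mem_support_iff.2 hi)
  have hne : pderiv i p ≠ 0 := by
    intro h
    have hc := coeff_pderiv (i := i) p (s - Finsupp.single i 1)
    rw [h, coeff_zero, tsub_add_cancel_of_le (Finsupp.single_le_iff.2 hi')] at hc
    have hcast : (((s - Finsupp.single i 1 : σ →₀ ℕ) i : ℕ) : F) + 1 = (s i : F) := by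
      rw [Finsupp.tsub_apply, Finsupp.single_eq_same, Nat.cast_sub hi']
      simp
    rw [hcast] at hc
    exact mul_ne_zero (mem_support_iff.1 hs) (hF _ hi' hle) hc.symm
  refine ⟨i, fun hdvd => ?_⟩
  have h1 := totalDegree_le_of_dvd_of_isDomain hdvd hne
  have h2 := totalDegree_pderiv_le i p
  omega

/-- Differentiating `k` times lowers the multiplicity of a factor from `k + 1` to one. -/
theorem exists_iterate_pderiv_eq_mul {p : MvPolynomial σ F} (hp : Prime p) {i : σ}
    (hi : ¬ p ∣ pderiv i p) (k : ℕ) (hF : ∀ j : ℕ, 0 < j → j ≤ k + 1 → (j : F) ≠ 0)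
    {q : MvPolynomial σ F} (hq : ¬ p ∣ q) :
    ∃ r, (pderiv i)^[k] (p ^ (k + 1) * q) = p * r ∧ ¬ p ∣ r := by
  induction k generalizing q with
  | zero => exact ⟨q, by simp, hq⟩
  | succ k ih =>
    have hder : pderiv i (p ^ (k + 1 + 1) * q) =
        p ^ (k + 1) * (C ((k + 2 : ℕ) : F) * (pderiv i p * q) + p * pderiv i q) := by
      rw [pderiv_mul, pderiv_pow, map_natCast]
      push_cast
      ring
    rw [Function.iterate_succ_apply, hder]
    refine ih (fun j hj hjk => hF j hj (by omega)) fun hdvd => ?_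
    have hunit : IsUnit (C ((k + 2 : ℕ) : F) : MvPolynomial σ F) :=
      (Ne.isUnit (hF (k + 2) (by omega) le_rfl)).map C
    rw [dvd_add_left (dvd_mul_right p _), hunit.dvd_mul_left] at hdvd
    exact (hp.dvd_or_dvd hdvd).elim hi hq

theorem derivative_shift_single [DecidableEq σ] (i : σ) (p : MvPolynomial σ F) :
    Polynomial.derivative (shift (Pi.single i 1) p) = shift (Pi.single i 1) (pderiv i p) := by
  induction p using MvPolynomial.induction_on with
  | C c => simp
  | add p q hp hq => simp [hp, hq]
  | mul_X p j hp =>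
    rw [map_mul, Polynomial.derivative_mul, hp, pderiv_mul, map_add, map_mul, map_mul, shift_X]
    rcases eq_or_ne j i with rfl | hj
    · simp
    · simp [hj, pderiv_X_of_ne hj]

theorem coeff_zero_shift (b : σ → F) (p : MvPolynomial σ F) : (shift b p).coeff 0 = p := by
  have h : Polynomial.constantCoeff.comp (shift b).toRingHom = RingHom.id _ := by
    refine MvPolynomial.ringHom_ext (fun c => ?_) fun i => ?_
    · simp
    · simp [shift_X]
  exact RingHom.congr_fun h p

/-- The Taylor expansion of `p (x + y eᵢ)` in `y`. -/
theorem factorial_mul_coeff_shift_single [DecidableEq σ] (i : σ) (k : ℕ) (p : MvPolynomial σ F) :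
    C ((k.factorial : ℕ) : F) * (shift (Pi.single i 1) p).coeff k = (pderiv i)^[k] p := by
  induction k generalizing p with
  | zero => simp [coeff_zero_shift]
  | succ k ih =>
    rw [Function.iterate_succ_apply, ← ih, ← derivative_shift_single, Polynomial.coeff_derivative,
      Nat.factorial_succ]
    push_cast
    simp only [map_mul, map_add, map_natCast, map_one]
    ring

theorem eval_shift (b : σ → F) (p : MvPolynomial σ F) (z : F) :
    (shift b p).eval (C z) = aeval (fun i => C 1 * X i + C (b i * z)) p := by
  have h : (Polynomial.evalRingHom (C z)).comp (shift b).toRingHom =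
      (aeval (fun i => C 1 * X i + C (b i * z)) :
        MvPolynomial σ F →ₐ[F] MvPolynomial σ F).toRingHom := by
    refine MvPolynomial.ringHom_ext (fun c => ?_) fun i => ?_
    · simp
    · simp [shift_X]
  exact RingHom.congr_fun h p

/-- Iterated partial derivatives are computed by interpolation from translates; differentiating a
circuit repeatedly would be too costly. -/
theorem straightLine_iterate_pderiv {n s : ℕ} {f : MvPolynomial (Fin n) F}
    (hN : Set.InjOn (Nat.cast : ℕ → F) (Set.Iio (f.totalDegree + 1)))
    (h : StraightLine (circuitInputs F n) s {f}) (i : Fin n) (k : ℕ) :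
    StraightLine (circuitInputs F n) (pderivCost s n f.totalDegree) {(pderiv i)^[k] f} := by
  obtain ⟨c, hc⟩ := Polynomial.exists_coeff_eq_sum_eval (MvPolynomial (Fin n) F) hN
  have hC : StraightLine (circuitInputs F n) 0 {C ((k.factorial : ℕ) : F)} :=
    .of_subset (by simpa using C_mem_circuitInputs (n := n) ((k.factorial : ℕ) : F))
  rw [← factorial_mul_coeff_shift_single, hc _ (Nat.lt_succ_of_le (natDegree_shift_le _ _)) k]
  refine (hC.mul_mul (StraightLine.sum_mul (c := n * 2 + s) _ _ _ ?_ (fun j _ => ?_)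
    fun j _ => ?_)).mono_cost ?_
  · simpa using C_mem_circuitInputs (n := n) (0 : F)
  · exact C_mem_circuitInputs _
  · rw [algebraMap_eq, eval_shift]
    exact h.affine_subst _ _
  · rw [Finset.card_range, zero_add, pderivCost]

end MvPolynomial

/-! ### Factors -/

/-- The cost of an irreducible factor of a polynomial of degree `d` with cost `s`. -/
def irreducibleFactorCost {A : Type*} [CommSemiring A] (s n d : A) : A :=
  lineCost (pderivCost s n d) n d + henselCost d + (d + 1)

/-- The circuit size of a factor of a polynomial of degree `d` with circuit size `s`. -/
def factorSize {A : Type*} [CommSemiring A] (s n d : A) : A :=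
  2 * (d * (irreducibleFactorCost s n d + 1)) + 1

theorem factorSize_mono {s s' n n' d d' : ℕ} (hs : s ≤ s') (hn : n ≤ n') (hd : d ≤ d') :
    factorSize s n d ≤ factorSize s' n' d' := by
  unfold factorSize irreducibleFactorCost lineCost pderivCost henselCost
  gcongr

theorem map_factorSize {A A' : Type*} [CommSemiring A] [CommSemiring A'] (φ : A →+* A')
    (s n d : A) : φ (factorSize s n d) = factorSize (φ s) (φ n) (φ d) := by
  have h2 : φ 2 = 2 := map_ofNat φ 2
  simp [h2, factorSize, irreducibleFactorCost, lineCost, pderivCost, henselCost]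

namespace MvPolynomial

variable {F : Type*} [Field F]

theorem straightLine_of_irreducible_factor {n s : ℕ} {f g : MvPolynomial (Fin n) F} (hf : f ≠ 0)
    (hN : Set.InjOn (Nat.cast : ℕ → F) (Set.Iio (f.totalDegree ^ 2 + 1)))
    (hs : StraightLine (circuitInputs F n) s {f}) (hg : Irreducible g) (hgf : g ∣ f) :
    StraightLine (circuitInputs F n) (irreducibleFactorCost s n f.totalDegree) {g} := by
  have hsq : f.totalDegree ≤ f.totalDegree ^ 2 := Nat.le_self_pow two_ne_zero _
  have hF : ∀ k : ℕ, 0 < k → k ≤ f.totalDegree → (k : F) ≠ 0 := fun k hk hkd h0 =>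
    hk.ne' (hN (Set.mem_Iio.2 (by omega)) (Set.mem_Iio.2 (by omega)) (by simpa using h0))
  obtain ⟨i, hi⟩ := exists_not_dvd_pderiv hg fun k hk hkg =>
    hF k hk (hkg.trans (totalDegree_le_of_dvd_of_isDomain hgf hf))
  obtain ⟨e, q, hq, hfq⟩ := WfDvdMonoid.max_power_factor hf hg
  have hpos := totalDegree_pos_of_irreducible hg
  have hpow : ∀ k : ℕ, k ≤ (g ^ k).totalDegree := by
    intro k
    induction k with
    | zero => exact Nat.zero_le _
    | succ k ih =>
      rw [pow_succ, totalDegree_mul_of_isDomain (pow_ne_zero _ hg.ne_zero) hg.ne_zero]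
      omega
  have he : e ≤ f.totalDegree :=
    (hpow e).trans (totalDegree_le_of_dvd_of_isDomain ⟨q, hfq⟩ hf)
  obtain ⟨k, rfl⟩ : ∃ k, e = k + 1 := Nat.exists_eq_succ_of_ne_zero <| by
    rintro rfl
    exact hq (by simpa [hfq] using hgf)
  obtain ⟨r, hr, hgr⟩ := exists_iterate_pderiv_eq_mul hg.prime hi k
    (fun j hj hjk => hF j hj (hjk.trans he)) hq
  rw [← hfq] at hr
  have hD := straightLine_iterate_pderiv (hN.mono (Set.Iio_subset_Iio (by omega))) hs i k
  have hdeg := totalDegree_iterate_pderiv_le i f k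
  rw [hr] at hD hdeg
  have hr0 : r ≠ 0 := fun h => hgr (h ▸ dvd_zero g)
  have hdeg2 : (g * r).totalDegree ^ 2 ≤ f.totalDegree ^ 2 := Nat.pow_le_pow_left hdeg 2
  refine (straightLine_of_simple_factor hg.prime hr0 hgr
    (hN.mono (Set.Iio_subset_Iio (by omega))) hD).mono_cost ?_
  unfold irreducibleFactorCost lineCost henselCost
  gcongr

/-- A factor is a product of at most as many irreducible factors as its degree; the irreducible
ones are computed separately. -/
theorem straightLine_of_factor {n s : ℕ} {f g : MvPolynomial (Fin n) F} (hf : f ≠ 0)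
    (hN : Set.InjOn (Nat.cast : ℕ → F) (Set.Iio (f.totalDegree ^ 2 + 1)))
    (hs : StraightLine (circuitInputs F n) s {f}) (hgf : g ∣ f) :
    StraightLine (circuitInputs F n)
      (g.totalDegree * (irreducibleFactorCost s n f.totalDegree + 1)) {g} := by
  induction g using WfDvdMonoid.induction_on_irreducible with
  | zero => exact absurd (zero_dvd_iff.1 hgf) hf
  | unit u hu =>
    obtain ⟨c, -, rfl⟩ := MvPolynomial.isUnit_iff_eq_C_of_isReduced.1 hu
    exact .of_subset (by simpa using C_mem_circuitInputs c)
  | mul a p ha hp ih =>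
    have hpos := totalDegree_pos_of_irreducible hp
    refine ((straightLine_of_irreducible_factor hf hN hs hp
      ((dvd_mul_right p a).trans hgf)).mul_mul (ih ((dvd_mul_left a p).trans hgf))).mono_cost ?_
    rw [totalDegree_mul_of_isDomain hp.ne_zero ha, add_mul]
    have := Nat.mul_le_mul_right (irreducibleFactorCost s n f.totalDegree + 1) hpos
    omega

end MvPolynomial

theorem HasCircuitOfSize.factor {F : Type*} [Field F] {n s : ℕ} {f g : MvPolynomial (Fin n) F}
    (hf : f ≠ 0) (hF : ringChar F = 0 ∨ f.totalDegree ^ 2 + 1 ≤ ringChar F)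
    (hs : HasCircuitOfSize f s) (hgf : g ∣ f) :
    HasCircuitOfSize g (factorSize s n f.totalDegree) := by
  have hN : Set.InjOn (Nat.cast : ℕ → F) (Set.Iio (f.totalDegree ^ 2 + 1)) := by
    rcases hF with h | h
    · have := (CharP.ringChar_zero_iff_CharZero F).1 h
      exact Nat.cast_injective.injOn
    · exact (CharP.natCast_injOn_Iio F (ringChar F)).mono (Set.Iio_subset_Iio h)
  obtain ⟨C, hC, hsize⟩ :=
    (MvPolynomial.straightLine_of_factor hf hN hs.straightLine hgf).hasCircuitOfSize
  refine ⟨C, hC, hsize.trans ?_⟩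
  unfold factorSize
  gcongr
  exact MvPolynomial.totalDegree_le_of_dvd_of_isDomain hgf hf

theorem theorem1p1 :
    (∃ (Φ : MvPolynomial (Fin 3) ℕ) (T : Polynomial ℕ),
      ∀ (F : Type*) [Field F] (s n d : ℕ) (f g : MvPolynomial (Fin n) F),
        (ringChar F = 0 ∨ T.eval d ≤ ringChar F) →
        f ≠ 0 → f.totalDegree = d → HasCircuitOfSize f s → g ∣ f →
        HasCircuitOfSize g (MvPolynomial.eval ![s, n, d] Φ)) ∧
    (∀ (F : Type*) [Field F] [CharZero F] (n : ℕ → ℕ) (f g : ∀ m, MvPolynomial (Fin (n m)) F),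
        IsVP n f → (∀ m, f m ≠ 0) → (∀ m, g m ∣ f m) → IsVP n g) := by
  refine ⟨⟨factorSize (MvPolynomial.X 0) (MvPolynomial.X 1) (MvPolynomial.X 2),
    Polynomial.X ^ 2 + 1, ?_⟩, ?_⟩
  · rintro F _ s n d f g hF hf rfl hs hgf
    rw [map_factorSize]
    simpa using hs.factor hf (by simpa using hF) hgf
  · rintro F _ _ n f g ⟨hn, ⟨Pd, hd⟩, s, ⟨Ps, hPs⟩, hs⟩ hf hgf
    obtain ⟨Pn, hPn⟩ := id hn
    refine ⟨hn, ⟨Pd, fun m => ?_⟩, fun m => factorSize (s m) (n m) (f m).totalDegree,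
      ⟨factorSize Ps Pn Pd, fun m => ?_⟩, fun m => ?_⟩
    · exact (MvPolynomial.totalDegree_le_of_dvd_of_isDomain (hgf m) (hf m)).trans (hd m)
    · refine (factorSize_mono (hPs m) (hPn m) (hd m)).trans_eq ?_
      exact (map_factorSize (Polynomial.evalRingHom m) Ps Pn Pd).symm
    · exact (hs m).factor (hf m) (Or.inl ((CharP.ringChar_zero_iff_CharZero F).2 inferInstance))
        (hgf m)
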